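/- Consider a series of images $y_{i,t,w}$, $1\le t\le T$, where $i$ runs over the $N_I=n_1n_2$ pixels of an $n_1\times n_2$ grid (pixels sharing an edge are neighbours) and $w=1,\dots,N_w$ ($N_w\ge 1$) over energy bands. A *segmentation* $R$ assigns each pixel $i$ a region $R(i)\in\{1,\dots,m\}$, all regions being nonempty and connected; $a_h$ is the number of pixels of region $h$ and $b_h$ the number of pixel edges between region $h$ and other regions. Let $\mathcal M$ be the set of pairs $\psi=(R,\mu)$ with $\mu=(\mu_{h,w})\in\Theta(R)$, where for every $R$ the set $\Theta(R)$ is a given compact set of arrays of positive numbers. Put $l(\psi;Y_t)=\sum_{w}\sum_{i}[\,y_{i,t,w}\log\mu_{R(i),w}-\mu_{R(i),w}]$. Fix $\epsilon>0$ and let $A^K_\epsilon$ be the set of $\nu\in(0,1)^K$ with $\nu_k-\nu_{k-1}>\epsilon$ for $1\le k\le K+1$, where $\nu_0=0$, $\nu_{K+1}=1$. For $\nu\in A_\epsilon^K$ and $\psi=(\psi_1,\dots,\psi_{K+1})\in\mathcal M^{K+1}$, $\psi_k=(R^{(k)},\mu^{(k)})$, let $$\mathrm{MDL}(K,\nu,\psi)=K\log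 T+\sum_{k=1}^{K+1}\Big[m^{(k)}\log N_I+\tfrac{\log 3}{2}\sum_{h}b^{(k)}_h+\tfrac{N_w}{2}\sum_{h}\log\big(([T\nu_k]-[T\nu_{k-1}]+1)\,a^{(k)}_h\big)\Big]-\sum_{k=1}^{K+1}\ \sum_{t=[T\nu_{k-1}]+1}^{[T\nu_k]}l(\psi_k;Y_t).$$ For each $T\ge 1$ let $(\hat K_T,\hat\nu_T,\hat\psi_T)$ almost surely be a minimizer of $\frac1T\mathrm{MDL}(K,\nu,\psi)$ over $K\le[1/\epsilon]+1$, $\nu\in A^K_\epsilon$, $\psi\in\mathcal M^{K+1}$. Let the data follow a true model $(K^o,\nu^o,\psi^o)$ with $\nu^o\in A^{K^o}_\epsilon$ and $\psi^o_k=(R^{o(k)},\mu^{o(k)})\in\mathcal M$: there are independent variables $x^{(k)}_{i,s,w}\sim\mathrm{Poisson}\big(\mu^{o(k)}_{R^{o(k)}(i),w}\big)$ ($1\le k\le K^o+1$, $s\ge1$), not depending on $T$, such that $y_{i,t,w}=x^{(k)}_{i,\,t-[T\nu^o_{k-1}],\,w}$ for $[T\nu^o_{k-1}]<t\le[T\nu^o_k]$.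 Assume that within each true interval neighbouring regions $p\ne q$ satisfy $\mu^{o(k)}_{p,w}\ne\mu^{o(k)}_{q,w}$ for all $w$, and that for any two consecutive true intervals there are a pixel $i$ and a band $w$ with $\mu^{o(k)}_{R^{o(k)}(i),w}\neq\mu^{o(k+1)}_{R^{o(k+1)}(i),w}$. Then: 1. Almost surely, $\hat K_T\ge K^o$ for all sufficiently large $T$. 2. Almost surely, when $\hat K_T>K^o$, the true change points are among the limits of the estimated ones: for every $\delta>0$ and all sufficiently large $T$ with $\hat K_T>K^o$, every $\nu^o_k$, $1\le k\le K^o$, is within $\delta$ of some $\hat\nu_{T,j}$, $1\le j\le\hat K_T$; and whenever along a subsequence $\hat K_{T_n}=K>K^o$ is constant and $\hat\nu_{T_n}\to\nu^*$, one has $\{\nu^o_1,\dots,\nu^o_{K^o}\}\subseteq\{\nu^*_1,\dots,\nu^*_K\}$. 3. Almost surely, for every $\delta>0$ and all sufficiently large $T$, for each fitted interval $j\in\{1,\dots,\hat K_T+1\}$ there is a true interval $k$ such that $\nu^o_{k-1}-\delta<\hat\nu_{T,j-1}$, $\hat\nu_{T,j}<\nu^o_k+\delta$, and $\hat R^{(j)}$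 equals or oversegments $R^{o(k)}$, i.e. $\hat R^{(j)}(i)=\hat R^{(j)}(i')$ implies $R^{o(k)}(i)=R^{o(k)}(i')$ for all pixels $i,i'$. -/

import Mathlib

open MeasureTheory ProbabilityTheory Filter Topology

noncomputable section

/-- The pixels of an `n₁ × n₂` image. -/
abbrev Pixel (n₁ n₂ : ℕ) : Type := Fin n₁ × Fin n₂

/-- Neighbouring pixels of the image: two pixels are adjacent iff they share an edge. -/
def pixelGraph (n₁ n₂ : ℕ) : SimpleGraph (Pixel n₁ n₂) :=
  SimpleGraph.boxProd (SimpleGraph.pathGraph n₁) (SimpleGraph.pathGraph n₂)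

/-- A segmentation of the image into `m` regions, given by its region assignment function.
Every region is connected; in particular (`SimpleGraph.Connected` contains it) it is nonempty. -/
structure Segmentation (n₁ n₂ : ℕ) where
  m : ℕ
  label : Pixel n₁ n₂ → Fin m
  connected : ∀ h : Fin m, ((pixelGraph n₁ n₂).induce {i | label i = h}).Connected

/-- The area (number of pixels) of region `h`. -/
def Segmentation.area {n₁ n₂ : ℕ} (R : Segmentation n₁ n₂) (h : Fin R.m) : ℕ :=
  (Finset.univ.filter fun i : Pixel n₁ n₂ => R.label i = h).card

open Classical in
/-- The perimeter of region `h`: the number of pixel edges between it and neighbouring regions. -/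
def Segmentation.perimeter {n₁ n₂ : ℕ} (R : Segmentation n₁ n₂) (h : Fin R.m) : ℕ :=
  (Finset.univ.filter fun e : Pixel n₁ n₂ × Pixel n₁ n₂ =>
    (pixelGraph n₁ n₂).Adj e.1 e.2 ∧ R.label e.1 = h ∧ R.label e.2 ≠ h).card

/-- `Rb` is equal to, or an oversegmentation of, `Rs`. -/
def Oversegments {n₁ n₂ : ℕ} (Rb Rs : Segmentation n₁ n₂) : Prop :=
  ∀ i j : Pixel n₁ n₂, Rb.label i = Rb.label j → Rs.label i = Rs.label j

/-- The parameter `(R, μ)` of one time interval: a segmentation, and a Poisson rate for each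
region and each of the `nw` energy bands. -/
structure RegionModel (n₁ n₂ nw : ℕ) where
  seg : Segmentation n₁ n₂
  rate : Fin seg.m → Fin nw → ℝ

/-- The Poisson rate of pixel `i` in band `w`. -/
def RegionModel.intensity {n₁ n₂ nw : ℕ} (ψ : RegionModel n₁ n₂ nw)
    (i : Pixel n₁ n₂) (w : Fin nw) : ℝ :=
  ψ.rate (ψ.seg.label i) w

/-- The Poisson log-likelihood of one image `y`, without the term that is free of parameters. -/
def RegionModel.logLik {n₁ n₂ nw : ℕ} (ψ : RegionModel n₁ n₂ nw)
    (y : Pixel n₁ n₂ → Fin nw → ℕ) : ℝ :=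
  ∑ w : Fin nw, ∑ h : Fin ψ.seg.m,
    ∑ i ∈ Finset.univ.filter (fun i : Pixel n₁ n₂ => ψ.seg.label i = h),
      ((y i w : ℝ) * Real.log (ψ.rate h w) - ψ.rate h w)

/-- A model `(K, ν, ψ)` for the series of images. The normalized change points are
`ν 1, …, ν K`; the entries `ν 0` and `ν (K + 1)` are the end points `0` and `1`
(see `SeriesModel.Admissible`). The `k`-th interval runs from `ν k.castSucc` to `ν k.succ`. -/
structure SeriesModel (n₁ n₂ nw : ℕ) where
  K : ℕ
  ν : Fin (K + 2) → ℝ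
  ψ : Fin (K + 1) → RegionModel n₁ n₂ nw

/-- The `K` normalized change points proper, without the end points `0` and `1`. -/
def SeriesModel.changePoint {n₁ n₂ nw : ℕ} (M : SeriesModel n₁ n₂ nw) (k : Fin M.K) : ℝ :=
  M.ν k.succ.castSucc

/-- The change points `[T ν_k]` on the time scale `0, …, T`. -/
def SeriesModel.tau {n₁ n₂ nw : ℕ} (M : SeriesModel n₁ n₂ nw) (T : ℕ)
    (k : Fin (M.K + 2)) : ℕ :=
  ⌊(T : ℝ) * M.ν k⌋₊

/-- The MDL criterion of the model `M` for the images `y 1, …, y T`. -/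
def SeriesModel.mdl {n₁ n₂ nw : ℕ} (M : SeriesModel n₁ n₂ nw) (T : ℕ)
    (y : ℕ → Pixel n₁ n₂ → Fin nw → ℕ) : ℝ :=
  (M.K : ℝ) * Real.log (T : ℝ)
  + ∑ k : Fin (M.K + 1),
      (((M.ψ k).seg.m : ℝ) * Real.log ((n₁ * n₂ : ℕ) : ℝ)
        + Real.log 3 / 2 * ∑ h : Fin (M.ψ k).seg.m, ((M.ψ k).seg.perimeter h : ℝ)
        + (nw : ℝ) / 2 * ∑ h : Fin (M.ψ k).seg.m,
            Real.log (((M.tau T k.succ : ℝ) - (M.tau T k.castSucc : ℝ) + 1)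
              * ((M.ψ k).seg.area h : ℝ)))
  - ∑ k : Fin (M.K + 1), ∑ t ∈ Finset.Ioc (M.tau T k.castSucc) (M.tau T k.succ),
      (M.ψ k).logLik (y t)

/-- The models over which the criterion is minimized: at most `[1/ε] + 1` change points,
consecutive normalized change points more than `ε` apart, and in every interval a pair `(R, μ)`
with `μ` in the parameter space `Θ R`. -/
def SeriesModel.Admissible {n₁ n₂ nw : ℕ} (ε : ℝ)
    (Θ : (R : Segmentation n₁ n₂) → Set (Fin R.m → Fin nw → ℝ))
    (M : SeriesModel n₁ n₂ nw) : Prop :=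
  M.K ≤ ⌊1 / ε⌋₊ + 1 ∧
  M.ν 0 = 0 ∧ M.ν (Fin.last (M.K + 1)) = 1 ∧
  (∀ k : Fin (M.K + 1), ε < M.ν k.succ - M.ν k.castSucc) ∧
  (∀ k : Fin (M.K + 1), (M.ψ k).rate ∈ Θ (M.ψ k).seg)

/-- `M` is an MDL estimate from the images `y 1, …, y T`: it minimizes `MDL / T` over all
admissible models. -/
def IsMDLEstimate {n₁ n₂ nw : ℕ} (ε : ℝ)
    (Θ : (R : Segmentation n₁ n₂) → Set (Fin R.m → Fin nw → ℝ)) (T : ℕ)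
    (y : ℕ → Pixel n₁ n₂ → Fin nw → ℕ) (M : SeriesModel n₁ n₂ nw) : Prop :=
  M.Admissible ε Θ ∧
  ∀ M' : SeriesModel n₁ n₂ nw, M'.Admissible ε Θ →
    1 / (T : ℝ) * M.mdl T y ≤ 1 / (T : ℝ) * M'.mdl T y

/-- The image at time `t` in a series of length `T` with change points `[T ν_k]`: inside the
`k`-th interval it is the image number `t - [T ν_(k-1)]` of the `k`-th sequence `x k`. -/
def SeriesModel.observed {n₁ n₂ nw : ℕ} (M : SeriesModel n₁ n₂ nw)
    (x : Fin (M.K + 1) → ℕ → Pixel n₁ n₂ → Fin nw → ℕ) (T : ℕ) (t : ℕ)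
    (i : Pixel n₁ n₂) (w : Fin nw) : ℕ :=
  ∑ k : Fin (M.K + 1),
    if M.tau T k.castSucc < t ∧ t ≤ M.tau T k.succ then x k (t - M.tau T k.castSucc) i w else 0

end

/-!
The estimate has at most the criterion of the true model, and the penalties are `o(T)`. By the law
of large numbers, uniformly over all time windows, the difference of the two log-likelihoods on the
part that a fitted and a true interval have in common is the number of time points there times the
Kullback-Leibler divergence of the two laws of an image, up to `o(T)`. These divergences are
nonnegative, so each single product of number and divergence is `o(T)`; it is here that the rates
must stay in some `[a, b]` with `0 < a`.

The divergence of the Poisson laws of rates `p` and `q` is at least `(√p - √q) ^ 2`. Hence a fitted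
interval which overlaps a true one by a fixed proportion of the series has square roots of rates
uniformly close to the true ones. It cannot overlap two consecutive true intervals in this way,
since these have different rates somewhere; so every true change point has a fitted one nearby.
Likewise it cannot give one label to neighbouring pixels whose true labels, hence rates, differ.
As the fitted regions are connected, each of them lies in one true region.
-/

section Analysis

lemma eventually_forall_le_abs_le {U : ℕ → ℝ} (hU : U =o[atTop] fun n : ℕ => (n : ℝ)) {η : ℝ}
    (hη : 0 < η) : ∀ᶠ T : ℕ in atTop, ∀ n ≤ T, |U n| ≤ η * T := by
  obtain ⟨N, hN⟩ := eventually_atTop.1 (hU.bound hη)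
  have hlarge : ∀ᶠ T : ℕ in atTop, ∀ n ∈ Finset.range N, |U n| ≤ η * T :=
    (Finset.range N).eventually_all.2 fun n _ =>
      (tendsto_natCast_atTop_atTop.const_mul_atTop hη).eventually_ge_atTop |U n|
  filter_upwards [hlarge] with T hT n hn
  rcases lt_or_ge n N with hnN | hNn
  · exact hT n (Finset.mem_range.2 hnN)
  · calc |U n| ≤ η * n := by simpa using hN n hNn
      _ ≤ η * T := by gcongr

lemma sum_Ioc_sub_eq_sum_range_sub_sum_range (g : ℕ → ℝ) {d p q : ℕ} (hdp : d ≤ p) (hpq : p ≤ q) :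
    ∑ t ∈ Finset.Ioc p q, g (t - d) =
      ∑ s ∈ Finset.range (q - d), g (s + 1) - ∑ s ∈ Finset.range (p - d), g (s + 1) := by
  induction q, hpq using Nat.le_induction with
  | base => simp
  | succ q hpq ih =>
    rw [Finset.sum_Ioc_succ_top hpq, ih, Nat.sub_add_comm (hdp.trans hpq), Finset.sum_range_succ]
    ring

/- A window sum is a difference of two partial sums, so one bound on the partial sums up to `T`
controls all windows at once. -/
lemma eventually_abs_sum_Ioc_sub_le {g : ℕ → ℝ} {c : ℝ}
    (hg : Tendsto (fun n : ℕ => (∑ s ∈ Finset.range n, g (s + 1)) / n) atTop (𝓝 c)) {η : ℝ}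
    (hη : 0 < η) :
    ∀ᶠ T : ℕ in atTop, ∀ d p q : ℕ, d ≤ p → q ≤ T →
      |∑ t ∈ Finset.Ioc p q, (g (t - d) - c)| ≤ η * T := by
  have hU : (fun n : ℕ => ∑ s ∈ Finset.range n, (g (s + 1) - c)) =o[atTop]
      fun n : ℕ => (n : ℝ) := by
    refine (Asymptotics.isLittleO_iff_tendsto' ?_).2 ?_
    · filter_upwards [eventually_gt_atTop 0] with n hn h
      exact absurd (Nat.cast_eq_zero.1 h) hn.ne'
    · have h := hg.sub_const c
      rw [sub_self] at h
      refine h.congr' ?_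
      filter_upwards [eventually_gt_atTop 0] with n hn
      have : (n : ℝ) ≠ 0 := by positivity
      simp only [Finset.sum_sub_distrib, Finset.sum_const, Finset.card_range, nsmul_eq_mul]
      field_simp
  filter_upwards [eventually_forall_le_abs_le hU (half_pos hη)] with T hT d p q hdp hqT
  rcases le_total p q with hpq | hqp
  · rw [sum_Ioc_sub_eq_sum_range_sub_sum_range (fun s => g s - c) hdp hpq]
    calc _ ≤ η / 2 * T + η / 2 * T := (abs_sub _ _).trans
          (add_le_add (hT _ (by lia)) (hT _ (by lia)))
      _ = η * T := by ring
  · rw [Finset.Ioc_eq_empty_of_le hqp, Finset.sum_empty, abs_zero]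
    positivity

lemma mem_range_of_tendsto {ι α β : Type*} [Finite ι] [MetricSpace α] {F : Filter β}
    [F.NeBot] {u : β → ι → α} {l : ι → α} {a : α}
    (hu : ∀ j, Tendsto (fun n => u n j) F (𝓝 (l j)))
    (ha : ∀ δ > 0, ∀ᶠ n in F, ∃ j, dist (u n j) a < δ) : a ∈ Set.range l := by
  by_contra! hal
  have hpos (j : ι) : 0 < dist (l j) a := dist_pos.2 fun h => hal ⟨j, h⟩
  obtain ⟨δ, hδ, hδl⟩ : ∃ δ > 0, ∀ j, δ < dist (l j) a := by
    have h : ∀ᶠ δ in 𝓝[>] (0 : ℝ), ∀ j, δ < dist (l j) a :=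
      eventually_all.2 fun j => (eventually_lt_nhds (hpos j)).filter_mono nhdsWithin_le_nhds
    obtain ⟨δ, hδ, hδ0⟩ := (h.and self_mem_nhdsWithin).exists
    exact ⟨δ, hδ0, hδ⟩
  have hfar : ∀ᶠ n in F, ∀ j, δ < dist (u n j) a := eventually_all.2 fun j =>
    ((hu j).dist tendsto_const_nhds).eventually_const_lt (hδl j)
  obtain ⟨n, hn, j, hj⟩ := (hfar.and (ha δ hδ)).exists
  exact (hn j).not_gt hj

lemma sub_one_le_card_Ioc_floor {x : ℝ} (hx : 0 ≤ x) (y : ℝ) :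
    y - x - 1 ≤ ((Finset.Ioc ⌊x⌋₊ ⌊y⌋₊).card : ℝ) := by
  have hsub : (⌊y⌋₊ : ℝ) - ⌊x⌋₊ ≤ (⌊y⌋₊ - ⌊x⌋₊ : ℕ) := by
    rw [sub_le_iff_le_add]
    exact_mod_cast le_tsub_add
  rw [Nat.card_Ioc]
  linarith [Nat.floor_le hx, Nat.sub_one_lt_floor y]

lemma abs_log_sub_log_le {a b x y : ℝ} (ha : 0 < a) (hx : x ∈ Set.Icc a b)
    (hy : y ∈ Set.Icc a b) : |Real.log x - Real.log y| ≤ Real.log b - Real.log a := by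
  have hlog {z : ℝ} (hz : z ∈ Set.Icc a b) :
      Real.log a ≤ Real.log z ∧ Real.log z ≤ Real.log b :=
    ⟨Real.log_le_log ha hz.1, Real.log_le_log (ha.trans_le hz.1) hz.2⟩
  exact abs_sub_le_of_le_of_le (hlog hx).1 (hlog hx).2 (hlog hy).1 (hlog hy).2

lemma isLittleO_const_natCast (c : ℝ) : (fun _ : ℕ => c) =o[atTop] fun T : ℕ => (T : ℝ) :=
  (Asymptotics.isLittleO_const_id_atTop c).comp_tendsto tendsto_natCast_atTop_atTop

lemma isLittleO_log_natCast :
    (fun T : ℕ => Real.log (T : ℝ)) =o[atTop] fun T : ℕ => (T : ℝ) :=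
  Real.isLittleO_log_id_atTop.comp_tendsto tendsto_natCast_atTop_atTop

lemma isLittleO_log_of_le_mul {g : ℕ → ℝ} {A : ℝ} (hg : ∀ᶠ T in atTop, 1 ≤ g T)
    (hgA : ∀ᶠ T in atTop, g T ≤ A * T) :
    (fun T => Real.log (g T)) =o[atTop] fun T : ℕ => (T : ℝ) := by
  refine Asymptotics.IsBigO.trans_isLittleO (Asymptotics.IsBigO.of_bound 1 ?_)
    ((isLittleO_const_natCast (Real.log A)).add isLittleO_log_natCast)
  filter_upwards [hg, hgA] with T h1 h2
  obtain ⟨hA, hT⟩ : A ≠ 0 ∧ (T : ℝ) ≠ 0 := mul_ne_zero_iff.1 (by linarith)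
  rw [one_mul, ← Real.log_mul hA hT, Real.norm_of_nonneg (Real.log_nonneg h1),
    Real.norm_of_nonneg (Real.log_nonneg (h1.trans h2))]
  exact Real.log_le_log (by linarith) h2

end Analysis

section Poisson

open scoped NNReal

lemma hasSum_mul_poissonMeasure (r : ℝ≥0) :
    HasSum (fun n : ℕ => Real.exp (-r) * r ^ n / (n.factorial : ℝ) * (n : ℝ)) r := by
  rw [← hasSum_nat_add_iff' 1]
  have h := (hasSum_one_poissonMeasure r).mul_left (r : ℝ)
  simp only [Finset.range_one, Finset.sum_singleton, Nat.cast_zero, mul_zero, sub_zero]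
  rw [mul_one] at h
  refine h.congr_fun fun n => ?_
  have : (n.factorial : ℝ) ≠ 0 := by positivity
  rw [Nat.factorial_succ]
  push_cast
  field_simp
  ring

lemma integrable_natCast_poissonMeasure (r : ℝ≥0) :
    Integrable (fun n : ℕ => (n : ℝ)) (poissonMeasure r) := by
  rw [integrable_poissonMeasure_iff]
  simpa using (hasSum_mul_poissonMeasure r).summable

lemma integral_natCast_poissonMeasure (r : ℝ≥0) :
    ∫ n : ℕ, (n : ℝ) ∂(poissonMeasure r) = r := by
  rw [integral_poissonMeasure' (integrable_natCast_poissonMeasure r)]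
  simpa using (hasSum_mul_poissonMeasure r).tsum_eq

lemma ae_tendsto_average_poisson {Ω : Type*} [MeasurableSpace Ω] {P : Measure Ω}
    {Y : ℕ → Ω → ℕ} {r : ℝ≥0} (hlaw : ∀ s, HasLaw (Y s) (poissonMeasure r) P)
    (hindep : Pairwise fun s t => IndepFun (Y s) (Y t) P) :
    ∀ᵐ ω ∂P, Tendsto (fun n : ℕ => (∑ s ∈ Finset.range n, (Y s ω : ℝ)) / n) atTop (𝓝 r) := by
  have hcast : Measurable (fun n : ℕ => (n : ℝ)) := measurable_from_top
  have hint : Integrable (fun ω => (Y 0 ω : ℝ)) P := by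
    have h := integrable_natCast_poissonMeasure r
    rw [← (hlaw 0).map_eq] at h
    exact h.comp_aemeasurable (hlaw 0).aemeasurable
  have hmean : ∫ ω, (Y 0 ω : ℝ) ∂P = r :=
    ((hlaw 0).integral_comp hcast.aestronglyMeasurable).trans (integral_natCast_poissonMeasure r)
  rw [← hmean]
  exact strong_law_ae_real (fun s ω => (Y s ω : ℝ)) hint
    (fun s t hst => (hindep hst).comp hcast hcast)
    fun s => ((hlaw s).identDistrib (hlaw 0)).comp hcast

end Poisson

section Partition

variable {α : Type*} [LinearOrder α] {n : ℕ} {τ : Fin (n + 1) → α} {t : α}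

lemma exists_castSucc_lt_le_succ (h0 : τ 0 < t) (h1 : t ≤ τ (Fin.last n)) :
    ∃ k : Fin n, τ k.castSucc < t ∧ t ≤ τ k.succ := by
  by_contra! h
  exact (Fin.induction (motive := (τ · < t)) h0 h (Fin.last n)).not_ge h1

lemma eq_of_castSucc_lt_le_succ (hτ : Monotone τ) {k l : Fin n} (hk : τ k.castSucc < t)
    (hk' : t ≤ τ k.succ) (hl : τ l.castSucc < t) (hl' : t ≤ τ l.succ) : k = l := by
  have hle {p q : Fin n} (hp : t ≤ τ p.succ) (hq : τ q.castSucc < t) : q ≤ p := by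
    by_contra! hpq
    exact (hq.trans_le hp).not_ge (hτ (Fin.succ_le_castSucc_iff.2 hpq))
  exact le_antisymm (hle hl' hk) (hle hk' hl)

lemma sum_sum_inter_Ioc {M : Type*} [AddCommMonoid M] [LocallyFiniteOrder α] (hτ : Monotone τ)
    {s : Finset α} (hs : s ⊆ Finset.Ioc (τ 0) (τ (Fin.last n))) (f : α → M) :
    ∑ k : Fin n, ∑ t ∈ s ∩ Finset.Ioc (τ k.castSucc) (τ k.succ), f t = ∑ t ∈ s, f t := by
  simp_rw [← Finset.sum_ite_mem]
  rw [Finset.sum_comm]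
  refine Finset.sum_congr rfl fun t ht => ?_
  obtain ⟨h0, h1⟩ := Finset.mem_Ioc.1 (hs ht)
  obtain ⟨k, hk, hk'⟩ := exists_castSucc_lt_le_succ h0 h1
  rw [Finset.sum_eq_single k, if_pos (Finset.mem_Ioc.2 ⟨hk, hk'⟩)]
  · intro l _ hlk
    refine if_neg fun h => hlk ?_
    obtain ⟨hl, hl'⟩ := Finset.mem_Ioc.1 h
    exact eq_of_castSucc_lt_le_succ hτ hl hl' hk hk'
  · simp

end Partition

section Divergence

/-- The Kullback-Leibler divergence between the Poisson distributions of rates `a` and `b`, in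
closed form for positive rates. -/
noncomputable def poissonDiv (a b : ℝ) : ℝ := a * (Real.log a - Real.log b) - (a - b)

lemma sq_sqrt_sub_sqrt_le_poissonDiv {a b : ℝ} (ha : 0 < a) (hb : 0 < b) :
    (√a - √b) ^ 2 ≤ poissonDiv a b := by
  have hlog : Real.log b / 2 - Real.log a / 2 ≤ √b / √a - 1 := by
    rw [← Real.log_sqrt hb.le, ← Real.log_sqrt ha.le,
      ← Real.log_div (by positivity) (by positivity)]
    exact Real.log_le_sub_one_of_pos (by positivity)
  have hsqrt : a * (√b / √a) = √a * √b := by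
    rw [mul_div_left_comm, Real.div_sqrt, mul_comm]
  unfold poissonDiv
  nlinarith [mul_le_mul_of_nonneg_left hlog ha.le, Real.sq_sqrt ha.le, Real.sq_sqrt hb.le]

lemma poissonDiv_nonneg {a b : ℝ} (ha : 0 < a) (hb : 0 < b) : 0 ≤ poissonDiv a b :=
  (sq_nonneg _).trans (sq_sqrt_sub_sqrt_le_poissonDiv ha hb)

variable {n₁ n₂ nw : ℕ}

namespace RegionModel

/-- The Kullback-Leibler divergence between the laws of one image under `ψo` and under `ψ`, if all
counts are independent. -/
noncomputable def div (ψo ψ : RegionModel n₁ n₂ nw) : ℝ :=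
  ∑ i, ∑ w, poissonDiv (ψo.intensity i w) (ψ.intensity i w)

variable {ψo ψ : RegionModel n₁ n₂ nw}

lemma div_nonneg (ho : ∀ i w, 0 < ψo.intensity i w) (h : ∀ i w, 0 < ψ.intensity i w) :
    0 ≤ ψo.div ψ :=
  Finset.sum_nonneg fun i _ => Finset.sum_nonneg fun w _ => poissonDiv_nonneg (ho i w) (h i w)

lemma sq_sqrt_sub_sqrt_le_div (ho : ∀ i w, 0 < ψo.intensity i w)
    (h : ∀ i w, 0 < ψ.intensity i w) (i : Pixel n₁ n₂) (w : Fin nw) :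
    (√(ψo.intensity i w) - √(ψ.intensity i w)) ^ 2 ≤ ψo.div ψ := by
  have hnonneg (i w) : 0 ≤ poissonDiv (ψo.intensity i w) (ψ.intensity i w) :=
    poissonDiv_nonneg (ho i w) (h i w)
  calc _ ≤ poissonDiv (ψo.intensity i w) (ψ.intensity i w) :=
        sq_sqrt_sub_sqrt_le_poissonDiv (ho i w) (h i w)
    _ ≤ ∑ w, poissonDiv (ψo.intensity i w) (ψ.intensity i w) :=
        Finset.single_le_sum (fun w _ => hnonneg i w) (Finset.mem_univ w)
    _ ≤ ψo.div ψ :=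
        Finset.single_le_sum (f := fun i => ∑ w, poissonDiv (ψo.intensity i w) (ψ.intensity i w))
          (fun i _ => Finset.sum_nonneg fun w _ => hnonneg i w) (Finset.mem_univ i)

lemma logLik_eq_sum (ψ : RegionModel n₁ n₂ nw) (y : Pixel n₁ n₂ → Fin nw → ℕ) :
    ψ.logLik y = ∑ i, ∑ w, ((y i w : ℝ) * Real.log (ψ.intensity i w) - ψ.intensity i w) := by
  rw [logLik, Finset.sum_comm (s := Finset.univ (α := Pixel n₁ n₂))]
  refine Finset.sum_congr rfl fun w _ => ?_
  rw [← Finset.sum_fiberwise Finset.univ ψ.seg.label]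
  refine Finset.sum_congr rfl fun h _ => Finset.sum_congr rfl fun i hi => ?_
  rw [intensity, (Finset.mem_filter.1 hi).2]

lemma sum_logLik_sub (ψo ψ : RegionModel n₁ n₂ nw) (s : Finset ℕ)
    (y : ℕ → Pixel n₁ n₂ → Fin nw → ℕ) :
    ∑ t ∈ s, (ψo.logLik (y t) - ψ.logLik (y t)) = s.card * ψo.div ψ +
      ∑ i, ∑ w, (∑ t ∈ s, ((y t i w : ℝ) - ψo.intensity i w)) *
        (Real.log (ψo.intensity i w) - Real.log (ψ.intensity i w)) := by
  simp_rw [logLik_eq_sum, div, Finset.mul_sum, ← Finset.sum_sub_distrib, ← Finset.sum_add_distrib]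
  rw [Finset.sum_comm]
  refine Finset.sum_congr rfl fun i _ => ?_
  rw [Finset.sum_comm]
  refine Finset.sum_congr rfl fun w _ => ?_
  rw [Finset.sum_mul, ← nsmul_eq_mul, ← Finset.sum_const, ← Finset.sum_add_distrib]
  refine Finset.sum_congr rfl fun t _ => ?_
  rw [poissonDiv]
  ring

lemma card_mul_div_sub_le_sum_logLik_sub {s : Finset ℕ} {y : ℕ → Pixel n₁ n₂ → Fin nw → ℕ}
    {E L : ℝ} (hE : ∀ i w, |∑ t ∈ s, ((y t i w : ℝ) - ψo.intensity i w)| ≤ E)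
    (hL : ∀ i w, |Real.log (ψo.intensity i w) - Real.log (ψ.intensity i w)| ≤ L) :
    s.card * ψo.div ψ - Fintype.card (Pixel n₁ n₂) * nw * (E * L) ≤
      ∑ t ∈ s, (ψo.logLik (y t) - ψ.logLik (y t)) := by
  rw [sum_logLik_sub, sub_eq_add_neg]
  refine add_le_add le_rfl (neg_le_of_abs_le ?_)
  calc _ ≤ ∑ i, ∑ w, |(∑ t ∈ s, ((y t i w : ℝ) - ψo.intensity i w)) *
          (Real.log (ψo.intensity i w) - Real.log (ψ.intensity i w))| :=
        (Finset.abs_sum_le_sum_abs _ _).trans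
          (Finset.sum_le_sum fun i _ => Finset.abs_sum_le_sum_abs _ _)
    _ ≤ ∑ _i : Pixel n₁ n₂, ∑ _w : Fin nw, E * L := by
        gcongr with i _ w _
        rw [abs_mul]
        exact mul_le_mul (hE i w) (hL i w) (abs_nonneg _) ((abs_nonneg _).trans (hE i w))
    _ = _ := by
        simp only [Finset.sum_const, Finset.card_univ, nsmul_eq_mul, Fintype.card_fin]
        ring

end RegionModel

end Divergence

section Segmentation

lemma eq_of_reachable {V β : Type*} {G : SimpleGraph V} {f : V → β}
    (hf : ∀ u v, G.Adj u v → f u = f v) {u v : V} (h : G.Reachable u v) : f u = f v := by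
  obtain ⟨p⟩ := h
  induction p with
  | nil => rfl
  | cons hadj _ ih => exact (hf _ _ hadj).trans ih

variable {n₁ n₂ nw : ℕ}

namespace Segmentation

lemma label_surjective (R : Segmentation n₁ n₂) : Function.Surjective R.label := fun h =>
  let ⟨i, hi⟩ := (R.connected h).nonempty
  ⟨i, hi⟩

lemma one_le_area (R : Segmentation n₁ n₂) (h : Fin R.m) : 1 ≤ R.area h :=
  let ⟨i, hi⟩ := R.label_surjective h
  Finset.card_pos.2 ⟨i, by simpa using hi⟩

instance : Finite (Segmentation n₁ n₂) := by
  have hm (R : Segmentation n₁ n₂) : R.m < Fintype.card (Pixel n₁ n₂) + 1 := by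
    simpa [Nat.lt_succ_iff] using Fintype.card_le_of_surjective _ R.label_surjective
  refine Finite.of_injective (β := Σ m : Fin (Fintype.card (Pixel n₁ n₂) + 1),
    Pixel n₁ n₂ → Fin m) (fun R => ⟨⟨R.m, hm R⟩, R.label⟩) ?_
  rintro ⟨m, l, c⟩ ⟨m', l', c'⟩ h
  simp only [Sigma.mk.injEq, Fin.mk.injEq] at h
  obtain ⟨rfl, h⟩ := h
  obtain rfl := eq_of_heq h
  rfl

lemma oversegments_of_adj {Rb Rs : Segmentation n₁ n₂}
    (h : ∀ i j, (pixelGraph n₁ n₂).Adj i j → Rb.label i = Rb.label j →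
      Rs.label i = Rs.label j) : Oversegments Rb Rs := by
  intro i j hij
  have hreach := (Rb.connected (Rb.label j)).preconnected ⟨i, hij⟩ ⟨j, rfl⟩
  exact eq_of_reachable (f := fun u : {i | Rb.label i = Rb.label j} => Rs.label u)
    (fun u v huv => h u v huv (u.2.trans v.2.symm)) hreach

end Segmentation

lemma exists_rates_mem_Icc {Θ : (R : Segmentation n₁ n₂) → Set (Fin R.m → Fin nw → ℝ)}
    (hΘ_compact : ∀ R, IsCompact (Θ R)) (hΘ_pos : ∀ R, ∀ μ ∈ Θ R, ∀ h w, 0 < μ h w) :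
    ∃ a b, 0 < a ∧ ∀ R, ∀ μ ∈ Θ R, ∀ h w, μ h w ∈ Set.Icc a b := by
  set S : Set ℝ := ⋃ (R) (h) (w), (fun μ => μ h w) '' Θ R
  have hmem {R} {μ} (hμ : μ ∈ Θ R) (h w) : μ h w ∈ S := by
    simp only [S, Set.mem_iUnion]
    exact ⟨R, h, w, μ, hμ, rfl⟩
  have hS : IsCompact S := isCompact_iUnion fun R => isCompact_iUnion fun h =>
    isCompact_iUnion fun w => (hΘ_compact R).image (by fun_prop)
  have hS_pos : ∀ x ∈ S, 0 < x := by
    simp only [S, Set.mem_iUnion]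
    rintro _ ⟨R, h, w, μ, hμ, rfl⟩
    exact hΘ_pos R μ hμ h w
  obtain ⟨a, ha, haS⟩ := hS.exists_forall_le' continuousOn_id hS_pos
  obtain ⟨b, hb⟩ := hS.bddAbove
  exact ⟨a, b, ha, fun R μ hμ h w => ⟨haS _ (hmem hμ h w), hb (hmem hμ h w)⟩⟩

end Segmentation

variable {n₁ n₂ nw : ℕ} {ε : ℝ} {Θ : (R : Segmentation n₁ n₂) → Set (Fin R.m → Fin nw → ℝ)}

namespace SeriesModel

variable {M M' Mo : SeriesModel n₁ n₂ nw}

namespace Admissible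

variable (hM : M.Admissible ε Θ)
include hM

lemma K_le : M.K ≤ ⌊1 / ε⌋₊ + 1 := hM.1

lemma ν_zero : M.ν 0 = 0 := hM.2.1

lemma ν_last : M.ν (Fin.last (M.K + 1)) = 1 := hM.2.2.1

lemma lt_sub (k : Fin (M.K + 1)) : ε < M.ν k.succ - M.ν k.castSucc := hM.2.2.2.1 k

lemma rate_mem (k : Fin (M.K + 1)) : (M.ψ k).rate ∈ Θ (M.ψ k).seg := hM.2.2.2.2 k

lemma strictMono (hε : 0 < ε) : StrictMono M.ν :=
  Fin.strictMono_iff_lt_succ.2 fun k => by linarith [hM.lt_sub k]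

lemma nonneg (hε : 0 < ε) (k : Fin (M.K + 2)) : 0 ≤ M.ν k :=
  hM.ν_zero ▸ (hM.strictMono hε).monotone (Fin.zero_le k)

lemma le_one (hε : 0 < ε) (k : Fin (M.K + 2)) : M.ν k ≤ 1 :=
  hM.ν_last ▸ (hM.strictMono hε).monotone (Fin.le_last k)

lemma tau_zero (T : ℕ) : M.tau T 0 = 0 := by simp [tau, hM.ν_zero]

lemma tau_last (T : ℕ) : M.tau T (Fin.last (M.K + 1)) = T := by simp [tau, hM.ν_last]

lemma tau_monotone (hε : 0 < ε) (T : ℕ) : Monotone (M.tau T) := fun _ _ h =>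
  Nat.floor_mono (mul_le_mul_of_nonneg_left ((hM.strictMono hε).monotone h) T.cast_nonneg)

lemma tau_le (hε : 0 < ε) (T : ℕ) (k : Fin (M.K + 2)) : M.tau T k ≤ T :=
  (hM.tau_monotone hε T (Fin.le_last k)).trans_eq (hM.tau_last T)

lemma intensity_mem_Icc {a b : ℝ} (hΘ : ∀ R, ∀ μ ∈ Θ R, ∀ h w, μ h w ∈ Set.Icc a b)
    (k : Fin (M.K + 1)) (i : Pixel n₁ n₂) (w : Fin nw) :
    (M.ψ k).intensity i w ∈ Set.Icc a b :=
  hΘ _ _ (hM.rate_mem k) _ _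

lemma intensity_pos {a b : ℝ} (ha : 0 < a)
    (hΘ : ∀ R, ∀ μ ∈ Θ R, ∀ h w, μ h w ∈ Set.Icc a b) (k : Fin (M.K + 1)) (i : Pixel n₁ n₂)
    (w : Fin nw) : 0 < (M.ψ k).intensity i w :=
  ha.trans_le (hM.intensity_mem_Icc hΘ k i w).1

lemma observed_eq (hε : 0 < ε) (x : Fin (M.K + 1) → ℕ → Pixel n₁ n₂ → Fin nw → ℕ) {T t : ℕ}
    {k : Fin (M.K + 1)} (ht : t ∈ Finset.Ioc (M.tau T k.castSucc) (M.tau T k.succ))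
    (i : Pixel n₁ n₂) (w : Fin nw) :
    M.observed x T t i w = x k (t - M.tau T k.castSucc) i w := by
  rw [Finset.mem_Ioc] at ht
  rw [observed, Finset.sum_eq_single k, if_pos ht]
  · intro l _ hlk
    exact if_neg fun hl => hlk
      (eq_of_castSucc_lt_le_succ (hM.tau_monotone hε T) hl.1 hl.2 ht.1 ht.2)
  · simp

lemma one_le_length_mul_area (hε : 0 < ε) (T : ℕ) (k : Fin (M.K + 1))
    (h : Fin (M.ψ k).seg.m) :
    (1 : ℝ) ≤ ((M.tau T k.succ : ℝ) - (M.tau T k.castSucc : ℝ) + 1) * (M.ψ k).seg.area h := by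
  have htau : (M.tau T k.castSucc : ℝ) ≤ M.tau T k.succ := by
    exact_mod_cast hM.tau_monotone hε T k.castSucc_lt_succ.le
  have harea : (1 : ℝ) ≤ (M.ψ k).seg.area h := by exact_mod_cast (M.ψ k).seg.one_le_area h
  exact one_le_mul_of_one_le_of_one_le (by linarith) harea

lemma length_mul_area_le (hε : 0 < ε) {T : ℕ} (hT : 1 ≤ T) (k : Fin (M.K + 1))
    (h : Fin (M.ψ k).seg.m) :
    ((M.tau T k.succ : ℝ) - (M.tau T k.castSucc : ℝ) + 1) * (M.ψ k).seg.area h ≤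
      2 * (M.ψ k).seg.area h * T := by
  have htau : (M.tau T k.succ : ℝ) ≤ T := by exact_mod_cast hM.tau_le hε T _
  have hT' : (1 : ℝ) ≤ T := by exact_mod_cast hT
  calc _ ≤ (2 * T : ℝ) * (M.ψ k).seg.area h := by
        gcongr
        linarith [(M.tau T k.castSucc).cast_nonneg (α := ℝ)]
    _ = _ := by ring

end Admissible

section Penalty

/-- The part of the criterion that depends on the data only through their number `T`. -/
noncomputable def penalty (M : SeriesModel n₁ n₂ nw) (T : ℕ) : ℝ :=
  (M.K : ℝ) * Real.log (T : ℝ)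
  + ∑ k : Fin (M.K + 1),
      (((M.ψ k).seg.m : ℝ) * Real.log ((n₁ * n₂ : ℕ) : ℝ)
        + Real.log 3 / 2 * ∑ h : Fin (M.ψ k).seg.m, ((M.ψ k).seg.perimeter h : ℝ)
        + (nw : ℝ) / 2 * ∑ h : Fin (M.ψ k).seg.m,
            Real.log (((M.tau T k.succ : ℝ) - (M.tau T k.castSucc : ℝ) + 1)
              * ((M.ψ k).seg.area h : ℝ)))

lemma mdl_eq_penalty_sub (M : SeriesModel n₁ n₂ nw) (T : ℕ)
    (y : ℕ → Pixel n₁ n₂ → Fin nw → ℕ) :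
    M.mdl T y = M.penalty T - ∑ k : Fin (M.K + 1),
      ∑ t ∈ Finset.Ioc (M.tau T k.castSucc) (M.tau T k.succ), (M.ψ k).logLik (y t) := rfl

lemma Admissible.penalty_nonneg (hM : M.Admissible ε Θ) (hε : 0 < ε) (T : ℕ) :
    0 ≤ M.penalty T := by
  have hlog3 : 0 < Real.log 3 := Real.log_pos (by norm_num)
  have hlog (n : ℕ) : 0 ≤ Real.log n := Real.log_natCast_nonneg n
  have hlength (k h) := Real.log_nonneg (hM.one_le_length_mul_area hε T k h)
  refine add_nonneg (mul_nonneg (Nat.cast_nonneg _) (hlog T))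
    (Finset.sum_nonneg fun k _ => add_nonneg (add_nonneg ?_ ?_) ?_)
  · exact mul_nonneg (Nat.cast_nonneg _) (hlog _)
  · exact mul_nonneg (half_pos hlog3).le (Finset.sum_nonneg fun _ _ => Nat.cast_nonneg _)
  · exact mul_nonneg (by positivity) (Finset.sum_nonneg fun h _ => hlength k h)

lemma Admissible.isLittleO_penalty (hM : M.Admissible ε Θ) (hε : 0 < ε) :
    M.penalty =o[atTop] fun T : ℕ => (T : ℝ) := by
  unfold penalty
  refine (isLittleO_log_natCast.const_mul_left _).add (Asymptotics.IsLittleO.fun_sum fun k _ =>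
    (isLittleO_const_natCast _).add
      ((Asymptotics.IsLittleO.fun_sum fun h _ => ?_).const_mul_left _))
  exact isLittleO_log_of_le_mul (.of_forall fun T => hM.one_le_length_mul_area hε T k h)
    ((eventually_ge_atTop 1).mono fun T hT => hM.length_mul_area_le hε hT k h)

end Penalty

section Cell

/-- The time points that are in the `j`-th interval of `M` and in the `k`-th interval of `M'`. -/
noncomputable def cell (M M' : SeriesModel n₁ n₂ nw) (T : ℕ) (j : Fin (M.K + 1))
    (k : Fin (M'.K + 1)) : Finset ℕ :=
  Finset.Ioc (M.tau T j.castSucc) (M.tau T j.succ) ∩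
    Finset.Ioc (M'.tau T k.castSucc) (M'.tau T k.succ)

/-- The `j`-th interval of `M` and the `k`-th interval of `M'` have at least the length `δ` in
common, on the normalized time scale. -/
def OverlapsBy (M M' : SeriesModel n₁ n₂ nw) (δ : ℝ) (j : Fin (M.K + 1)) (k : Fin (M'.K + 1)) :
    Prop :=
  max (M.ν j.castSucc) (M'.ν k.castSucc) + δ ≤ min (M.ν j.succ) (M'.ν k.succ)

lemma Admissible.overlapsBy (hM : M.Admissible ε Θ) (hM' : M'.Admissible ε Θ) {δ : ℝ}
    (hδε : δ ≤ ε) {j : Fin (M.K + 1)} {k : Fin (M'.K + 1)}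
    (h : M.ν j.castSucc + δ ≤ M'.ν k.succ) (h' : M'.ν k.castSucc + δ ≤ M.ν j.succ) :
    M.OverlapsBy M' δ j k := by
  have hj := hM.lt_sub j
  have hk := hM'.lt_sub k
  rw [OverlapsBy, max_add]
  exact max_le (le_min (by linarith) h) (le_min h' (by linarith))

lemma OverlapsBy.mul_sub_one_le_card_cell {δ : ℝ} {j : Fin (M.K + 1)} {k : Fin (M'.K + 1)}
    (h : M.OverlapsBy M' δ j k) (h0 : 0 ≤ M.ν j.castSucc) (T : ℕ) :
    T * δ - 1 ≤ ((M.cell M' T j k).card : ℝ) := by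
  have hmono : Monotone fun x : ℝ => ⌊(T : ℝ) * x⌋₊ := fun _ _ hxy =>
    Nat.floor_mono (mul_le_mul_of_nonneg_left hxy T.cast_nonneg)
  have hcell : M.cell M' T j k =
      Finset.Ioc ⌊(T : ℝ) * max (M.ν j.castSucc) (M'.ν k.castSucc)⌋₊
        ⌊(T : ℝ) * min (M.ν j.succ) (M'.ν k.succ)⌋₊ := by
    rw [cell, Finset.Ioc_inter_Ioc]
    exact congrArg₂ _ hmono.map_max.symm hmono.map_min.symm
  rw [hcell]
  refine le_trans ?_ (sub_one_le_card_Ioc_floor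
    (mul_nonneg T.cast_nonneg (h0.trans (le_max_left _ _))) _)
  rw [← mul_sub]
  unfold OverlapsBy at h
  gcongr
  linarith

lemma Admissible.sum_cell (hM : M.Admissible ε Θ) (hM' : M'.Admissible ε Θ) (hε : 0 < ε) (T : ℕ)
    (j : Fin (M.K + 1)) (f : ℕ → ℝ) :
    ∑ k, ∑ t ∈ M.cell M' T j k, f t =
      ∑ t ∈ Finset.Ioc (M.tau T j.castSucc) (M.tau T j.succ), f t := by
  refine sum_sum_inter_Ioc (hM'.tau_monotone hε T) (Finset.Ioc_subset_Ioc ?_ ?_) f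
  · rw [hM'.tau_zero]
    exact Nat.zero_le _
  · rw [hM'.tau_last]
    exact hM.tau_le hε T _

lemma Admissible.mdl_sub_mdl (hM : M.Admissible ε Θ) (hM' : M'.Admissible ε Θ) (hε : 0 < ε)
    (T : ℕ) (y : ℕ → Pixel n₁ n₂ → Fin nw → ℕ) :
    M.mdl T y - M'.mdl T y = M.penalty T - M'.penalty T +
      ∑ j, ∑ k, ∑ t ∈ M.cell M' T j k, ((M'.ψ k).logLik (y t) - (M.ψ j).logLik (y t)) := by
  have hcomm (j k) : M'.cell M T k j = M.cell M' T j k := Finset.inter_comm _ _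
  simp only [mdl_eq_penalty_sub, Finset.sum_sub_distrib, ← hM.sum_cell hM' hε,
    ← hM'.sum_cell hM hε]
  rw [Finset.sum_comm (γ := Fin (M'.K + 1))]
  simp only [hcomm]
  ring

end Cell

end SeriesModel

section ChangePoint

namespace SeriesModel.Admissible

variable {M Mo : SeriesModel n₁ n₂ nw}

lemma lt_changePoint (hM : M.Admissible ε Θ) (hε : 0 < ε) (k : Fin M.K) :
    ε < M.changePoint k := by
  have h := hM.lt_sub k.castSucc
  rw [Fin.succ_castSucc] at h
  unfold changePoint
  linarith [hM.nonneg hε k.castSucc.castSucc]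

lemma changePoint_lt (hM : M.Admissible ε Θ) (hε : 0 < ε) (k : Fin M.K) :
    M.changePoint k < 1 - ε := by
  unfold changePoint
  linarith [hM.lt_sub k.succ, hM.le_one hε k.succ.succ]

lemma lt_changePoint_sub (hM : M.Admissible ε Θ) (hε : 0 < ε) {k l : Fin M.K} (hkl : k < l) :
    ε < M.changePoint l - M.changePoint k := by
  have hle : M.ν k.succ.succ ≤ M.ν l.succ.castSucc :=
    (hM.strictMono hε).monotone (Fin.succ_le_castSucc_iff.2 (Fin.succ_lt_succ_iff.2 hkl))
  unfold changePoint
  linarith [hM.lt_sub k.succ]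

lemma exists_abs_changePoint_sub_lt (hM : M.Admissible ε Θ) {δ c : ℝ} (hδ : 0 < δ)
    (hδc : δ ≤ c) (hcδ : c + δ ≤ 1)
    (h : ∀ j : Fin (M.K + 1), M.ν j.castSucc + δ ≤ c → M.ν j.succ < c + δ) :
    ∃ j : Fin M.K, |M.changePoint j - c| < δ := by
  obtain ⟨j, hj, hj'⟩ := exists_castSucc_lt_le_succ (τ := M.ν) (t := c)
    (by rw [hM.ν_zero]; linarith) (by rw [hM.ν_last]; linarith)
  rcases lt_or_ge c (M.ν j.castSucc + δ) with hlt | hge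
  · rcases Fin.eq_zero_or_eq_succ j with rfl | ⟨i, rfl⟩
    · rw [Fin.castSucc_zero, hM.ν_zero] at hlt
      linarith
    · exact ⟨i, abs_sub_lt_iff.2 ⟨by unfold changePoint; linarith,
        by unfold changePoint; linarith⟩⟩
  · have hlt := h j hge
    rcases Fin.eq_castSucc_or_eq_last j with ⟨i, rfl⟩ | rfl
    · rw [Fin.succ_castSucc] at hlt hj'
      exact ⟨i, abs_sub_lt_iff.2 ⟨by unfold changePoint; linarith,
        by unfold changePoint; linarith⟩⟩
    · rw [Fin.succ_last, hM.ν_last] at hlt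
      linarith

lemma K_le_of_abs_changePoint_sub_lt (hMo : Mo.Admissible ε Θ) (hε : 0 < ε)
    (h : ∀ k : Fin Mo.K, ∃ j : Fin M.K, |M.changePoint j - Mo.changePoint k| < ε / 2) :
    Mo.K ≤ M.K := by
  choose f hf using h
  have hinj : Function.Injective f := by
    intro k l hkl
    have hk := abs_lt.1 (hf k)
    have hl := abs_lt.1 (hf l)
    rw [← hkl] at hl
    by_contra hne
    rcases lt_or_gt_of_ne hne with hlt | hlt <;> linarith [hMo.lt_changePoint_sub hε hlt]
  simpa using Fintype.card_le_of_injective f hinj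

lemma exists_interval_overlapsBy (hMo : Mo.Admissible ε Θ) (hM : M.Admissible ε Θ) (hε : 0 < ε)
    {δ : ℝ} (hδ : 0 < δ) (hδε : 2 * δ ≤ ε) (j : Fin (M.K + 1))
    (h : ∀ k, M.ν j.castSucc + δ ≤ Mo.changePoint k → M.ν j.succ < Mo.changePoint k + δ) :
    ∃ k : Fin (Mo.K + 1), Mo.ν k.castSucc - δ < M.ν j.castSucc ∧
      M.ν j.succ < Mo.ν k.succ + δ ∧ M.OverlapsBy Mo δ j k := by
  have hj := hM.lt_sub j
  have hj0 := hM.nonneg hε j.castSucc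
  have hj1 := hM.le_one hε j.succ
  obtain ⟨k, hk, hk'⟩ := exists_castSucc_lt_le_succ (τ := Mo.ν) (t := M.ν j.castSucc + δ)
    (by rw [hMo.ν_zero]; linarith) (by rw [hMo.ν_last]; linarith)
  refine ⟨k, by linarith, ?_, hM.overlapsBy hMo (by linarith) hk' (by linarith)⟩
  rcases Fin.eq_castSucc_or_eq_last k with ⟨i, rfl⟩ | rfl
  · rw [Fin.succ_castSucc] at hk' ⊢
    exact h i hk'
  · rw [Fin.succ_last, hMo.ν_last]
    linarith

end SeriesModel.Admissible

end ChangePoint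

section Consistency

open SeriesModel

variable {M Mo : SeriesModel n₁ n₂ nw} {a b : ℝ}

lemma IsMDLEstimate.mdl_le {T : ℕ} {y : ℕ → Pixel n₁ n₂ → Fin nw → ℕ}
    (hM : IsMDLEstimate ε Θ T y M) (hMo : Mo.Admissible ε Θ) (hT : 0 < T) :
    M.mdl T y ≤ Mo.mdl T y :=
  le_of_mul_le_mul_left (hM.2 Mo hMo) (by positivity)

lemma IsMDLEstimate.sum_card_cell_mul_div_le {T : ℕ} {y : ℕ → Pixel n₁ n₂ → Fin nw → ℕ}
    (hM : IsMDLEstimate ε Θ T y M) (hMo : Mo.Admissible ε Θ) (hε : 0 < ε) (hT : 0 < T) {E L : ℝ}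
    (hE : ∀ j k i w, |∑ t ∈ M.cell Mo T j k, ((y t i w : ℝ) - (Mo.ψ k).intensity i w)| ≤ E)
    (hL : ∀ j k i w,
      |Real.log ((Mo.ψ k).intensity i w) - Real.log ((M.ψ j).intensity i w)| ≤ L) :
    ∑ j, ∑ k, (M.cell Mo T j k).card * (Mo.ψ k).div (M.ψ j) ≤
      Mo.penalty T + (M.K + 1) * (Mo.K + 1) * (Fintype.card (Pixel n₁ n₂) * nw * (E * L)) := by
  have hlogLik := Finset.sum_le_sum fun j (_ : j ∈ Finset.univ) => Finset.sum_le_sum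
    fun k (_ : k ∈ Finset.univ) =>
      RegionModel.card_mul_div_sub_le_sum_logLik_sub (hE j k) (hL j k)
  simp only [Finset.sum_sub_distrib, Finset.sum_const, Finset.card_univ, nsmul_eq_mul,
    Fintype.card_fin, Nat.cast_add, Nat.cast_one] at hlogLik
  have hmdl := hM.1.mdl_sub_mdl hMo hε T y
  simp only [Finset.sum_sub_distrib] at hmdl
  linarith [hM.mdl_le hMo hT, hM.1.penalty_nonneg hε T]

/-- The law of large numbers for the counts of each interval of `M`, pixel and band. The images of
an interval are numbered from `1`; `x k 0` is never observed. -/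
def SeriesModel.SatisfiesLLN (M : SeriesModel n₁ n₂ nw)
    (x : Fin (M.K + 1) → ℕ → Pixel n₁ n₂ → Fin nw → ℕ) : Prop :=
  ∀ k i w, Tendsto (fun n : ℕ => (∑ s ∈ Finset.range n, (x k (s + 1) i w : ℝ)) / n) atTop
    (𝓝 ((M.ψ k).intensity i w))

variable {x : Fin (Mo.K + 1) → ℕ → Pixel n₁ n₂ → Fin nw → ℕ}

lemma eventually_abs_sum_cell_sub_le (hε : 0 < ε) (hMo : Mo.Admissible ε Θ)
    (hx : Mo.SatisfiesLLN x) {η : ℝ} (hη : 0 < η) :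
    ∀ᶠ T : ℕ in atTop, ∀ (M : SeriesModel n₁ n₂ nw) (j : Fin (M.K + 1)) (k : Fin (Mo.K + 1)) i w,
      |∑ t ∈ M.cell Mo T j k, ((Mo.observed x T t i w : ℝ) - (Mo.ψ k).intensity i w)| ≤
        η * T := by
  have hwindow : ∀ᶠ T : ℕ in atTop, ∀ (k : Fin (Mo.K + 1)) i w (d p q : ℕ), d ≤ p → q ≤ T →
      |∑ t ∈ Finset.Ioc p q, ((x k (t - d) i w : ℝ) - (Mo.ψ k).intensity i w)| ≤ η * T := by
    simp only [eventually_all]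
    exact fun k i w =>
      eventually_abs_sum_Ioc_sub_le (g := fun s => (x k s i w : ℝ)) (hx k i w) hη
  filter_upwards [hwindow] with T hT M j k i w
  have hobs : ∀ t ∈ M.cell Mo T j k, (Mo.observed x T t i w : ℝ) - (Mo.ψ k).intensity i w =
      (x k (t - Mo.tau T k.castSucc) i w : ℝ) - (Mo.ψ k).intensity i w := fun t ht => by
    rw [hMo.observed_eq hε x (Finset.mem_inter.1 ht).2]
  rw [Finset.sum_congr rfl hobs, cell, Finset.Ioc_inter_Ioc]
  exact hT k i w _ _ _ (le_max_right _ _) ((min_le_right _ _).trans (hMo.tau_le hε T _))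

variable (ha : 0 < a) (hΘ : ∀ R, ∀ μ ∈ Θ R, ∀ h w, μ h w ∈ Set.Icc a b) (hε : 0 < ε)
  (hMo : Mo.Admissible ε Θ) (hx : Mo.SatisfiesLLN x)
include ha hΘ hε hMo hx

lemma eventually_card_cell_mul_div_le {η : ℝ} (hη : 0 < η) :
    ∀ᶠ T : ℕ in atTop, ∀ M : SeriesModel n₁ n₂ nw, IsMDLEstimate ε Θ T (Mo.observed x T) M →
      ∀ j k, (M.cell Mo T j k).card * (Mo.ψ k).div (M.ψ j) ≤ η * T := by
  set N : ℝ := Fintype.card (Pixel n₁ n₂) * nw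
  set L : ℝ := |Real.log b - Real.log a|
  obtain ⟨γ, hγ, hγη⟩ := exists_pos_mul_lt (half_pos hη)
    ((⌊1 / ε⌋₊ + 1 + 1) * (Mo.K + 1) * (N * L))
  filter_upwards [eventually_abs_sum_cell_sub_le hε hMo hx hγ,
    (hMo.isLittleO_penalty hε).bound (half_pos hη), eventually_gt_atTop 0] with T hdev hpen hT M hM
  have hterm (j k) : 0 ≤ ((M.cell Mo T j k).card : ℝ) * (Mo.ψ k).div (M.ψ j) :=
    mul_nonneg (Nat.cast_nonneg _)
      (RegionModel.div_nonneg (hMo.intensity_pos ha hΘ k) (hM.1.intensity_pos ha hΘ j))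
  have hK : (M.K : ℝ) ≤ ⌊1 / ε⌋₊ + 1 := by exact_mod_cast hM.1.K_le
  intro j k
  calc (M.cell Mo T j k).card * (Mo.ψ k).div (M.ψ j)
      ≤ ∑ k, (M.cell Mo T j k).card * (Mo.ψ k).div (M.ψ j) :=
        Finset.single_le_sum (fun k _ => hterm j k) (Finset.mem_univ k)
    _ ≤ ∑ j, ∑ k, (M.cell Mo T j k).card * (Mo.ψ k).div (M.ψ j) :=
        Finset.single_le_sum
          (f := fun j => ∑ k, (M.cell Mo T j k).card * (Mo.ψ k).div (M.ψ j))
          (fun j _ => Finset.sum_nonneg fun k _ => hterm j k) (Finset.mem_univ j)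
    _ ≤ Mo.penalty T + (M.K + 1) * (Mo.K + 1) * (N * (γ * T * L)) :=
        hM.sum_card_cell_mul_div_le hMo hε hT (hdev M) fun j k i w =>
          (abs_log_sub_log_le ha (hMo.intensity_mem_Icc hΘ k i w)
            (hM.1.intensity_mem_Icc hΘ j i w)).trans (le_abs_self _)
    _ ≤ η / 2 * T + (⌊1 / ε⌋₊ + 1 + 1) * (Mo.K + 1) * (N * (γ * T * L)) := by
        gcongr
        simpa using (le_abs_self _).trans hpen
    _ = η / 2 * T + (⌊1 / ε⌋₊ + 1 + 1) * (Mo.K + 1) * (N * L) * γ * T := by ring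
    _ ≤ η / 2 * T + η / 2 * T := by gcongr
    _ = η * T := by ring

lemma eventually_abs_sqrt_intensity_sub_lt {δ η : ℝ} (hδ : 0 < δ) (hη : 0 < η) :
    ∀ᶠ T : ℕ in atTop, ∀ M : SeriesModel n₁ n₂ nw, IsMDLEstimate ε Θ T (Mo.observed x T) M →
      ∀ j k, M.OverlapsBy Mo δ j k → ∀ i w,
        |√((Mo.ψ k).intensity i w) - √((M.ψ j).intensity i w)| < η := by
  have hlarge : ∀ᶠ T : ℕ in atTop, 2 / δ < (T : ℝ) :=
    tendsto_natCast_atTop_atTop.eventually_gt_atTop _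
  filter_upwards [eventually_card_cell_mul_div_le ha hΘ hε hMo hx
    (show 0 < η ^ 2 * (δ / 2) by positivity), hlarge] with T hdiv hlarge M hM j k hjk i w
  have hcard : T * (δ / 2) < ((M.cell Mo T j k).card : ℝ) := by
    rw [div_lt_iff₀ hδ] at hlarge
    linarith [hjk.mul_sub_one_le_card_cell (hM.1.nonneg hε _) T]
  have hcard_pos : 0 < ((M.cell Mo T j k).card : ℝ) := lt_of_le_of_lt (by positivity) hcard
  refine abs_lt_of_sq_lt_sq ?_ hη.le
  calc _ ≤ (Mo.ψ k).div (M.ψ j) :=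
        RegionModel.sq_sqrt_sub_sqrt_le_div (hMo.intensity_pos ha hΘ k)
          (hM.1.intensity_pos ha hΘ j) i w
    _ < η ^ 2 := by
        refine lt_of_mul_lt_mul_left ?_ hcard_pos.le
        calc _ ≤ η ^ 2 * (δ / 2) * T := hdiv M hM j k
          _ = T * (δ / 2) * η ^ 2 := by ring
          _ < (M.cell Mo T j k).card * η ^ 2 := by gcongr

lemma eventually_intensity_ne {δ : ℝ} (hδ : 0 < δ) {k l : Fin (Mo.K + 1)} {i i' : Pixel n₁ n₂}
    {w : Fin nw} (hne : (Mo.ψ k).intensity i w ≠ (Mo.ψ l).intensity i' w) :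
    ∀ᶠ T : ℕ in atTop, ∀ M : SeriesModel n₁ n₂ nw, IsMDLEstimate ε Θ T (Mo.observed x T) M →
      ∀ j, M.OverlapsBy Mo δ j k → M.OverlapsBy Mo δ j l →
        (M.ψ j).intensity i w ≠ (M.ψ j).intensity i' w := by
  have hnonneg (k i) : 0 ≤ (Mo.ψ k).intensity i w := (hMo.intensity_pos ha hΘ k i w).le
  have hgap : 0 < |√((Mo.ψ k).intensity i w) - √((Mo.ψ l).intensity i' w)| :=
    abs_pos.2 (sub_ne_zero.2 fun h => hne ((Real.sqrt_inj (hnonneg _ _) (hnonneg _ _)).1 h))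
  filter_upwards [eventually_abs_sqrt_intensity_sub_lt ha hΘ hε hMo hx hδ (half_pos hgap)]
    with T hT M hM j hjk hjl heq
  have hk := hT M hM j k hjk i w
  have hl := hT M hM j l hjl i' w
  rw [← heq, abs_sub_comm] at hl
  linarith [abs_sub_le √((Mo.ψ k).intensity i w) √((M.ψ j).intensity i w)
    √((Mo.ψ l).intensity i' w)]

lemma eventually_lt_changePoint_add
    (hintervals : ∀ k : Fin Mo.K, ∃ i w,
      (Mo.ψ k.succ).intensity i w ≠ (Mo.ψ k.castSucc).intensity i w)
    {δ : ℝ} (hδ : 0 < δ) (hδε : δ ≤ ε) :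
    ∀ᶠ T : ℕ in atTop, ∀ M : SeriesModel n₁ n₂ nw, IsMDLEstimate ε Θ T (Mo.observed x T) M →
      ∀ (j : Fin (M.K + 1)) (k : Fin Mo.K),
        M.ν j.castSucc + δ ≤ Mo.changePoint k → M.ν j.succ < Mo.changePoint k + δ := by
  choose i w hne using hintervals
  filter_upwards [eventually_all.2 fun k => eventually_intensity_ne ha hΘ hε hMo hx hδ (hne k)]
    with T hT M hM j k hleft
  by_contra! hright
  have hsucc := hMo.lt_sub k.succ
  have hcastSucc := hMo.lt_sub k.castSucc
  rw [Fin.succ_castSucc] at hcastSucc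
  unfold changePoint at hleft hright
  refine hT k M hM j (hM.1.overlapsBy hMo hδε ?_ ?_) (hM.1.overlapsBy hMo hδε ?_ ?_) rfl
  · linarith
  · exact hright
  · exact hleft
  · linarith

lemma eventually_oversegments_of_overlapsBy
    (hregions : ∀ k i j, (pixelGraph n₁ n₂).Adj i j →
      (Mo.ψ k).seg.label i ≠ (Mo.ψ k).seg.label j →
      ∃ w, (Mo.ψ k).intensity i w ≠ (Mo.ψ k).intensity j w)
    {δ : ℝ} (hδ : 0 < δ) :
    ∀ᶠ T : ℕ in atTop, ∀ M : SeriesModel n₁ n₂ nw, IsMDLEstimate ε Θ T (Mo.observed x T) M →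
      ∀ j k, M.OverlapsBy Mo δ j k → Oversegments (M.ψ j).seg (Mo.ψ k).seg := by
  have hsep : ∀ᶠ T : ℕ in atTop, ∀ k i i', (pixelGraph n₁ n₂).Adj i i' →
      (Mo.ψ k).seg.label i ≠ (Mo.ψ k).seg.label i' →
      ∀ M : SeriesModel n₁ n₂ nw, IsMDLEstimate ε Θ T (Mo.observed x T) M →
        ∀ j, M.OverlapsBy Mo δ j k → ∃ w, (M.ψ j).intensity i w ≠ (M.ψ j).intensity i' w := by
    simp only [eventually_all]
    intro k i i' hadj hlabel
    obtain ⟨w, hw⟩ := hregions k i i' hadj hlabel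
    filter_upwards [eventually_intensity_ne ha hΘ hε hMo hx hδ hw] with T hT M hM j hjk
    exact ⟨w, hT M hM j hjk hjk⟩
  filter_upwards [hsep] with T hT M hM j k hjk
  refine Segmentation.oversegments_of_adj fun i i' hadj hfit => ?_
  by_contra hlabel
  obtain ⟨w, hw⟩ := hT k i i' hadj hlabel M hM j hjk
  exact hw (by rw [RegionModel.intensity, hfit, RegionModel.intensity])

lemma eventually_exists_abs_changePoint_sub_lt
    (hintervals : ∀ k : Fin Mo.K, ∃ i w,
      (Mo.ψ k.succ).intensity i w ≠ (Mo.ψ k.castSucc).intensity i w)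
    {δ : ℝ} (hδ : 0 < δ) :
    ∀ᶠ T : ℕ in atTop, ∀ M : SeriesModel n₁ n₂ nw, IsMDLEstimate ε Θ T (Mo.observed x T) M →
      ∀ k : Fin Mo.K, ∃ j : Fin M.K, |M.changePoint j - Mo.changePoint k| < δ := by
  have hγδ : min δ ε ≤ δ := min_le_left _ _
  have hγε : min δ ε ≤ ε := min_le_right _ _
  filter_upwards [eventually_lt_changePoint_add ha hΘ hε hMo hx hintervals (lt_min hδ hε) hγε]
    with T hT M hM k
  obtain ⟨j, hj⟩ := hM.1.exists_abs_changePoint_sub_lt (lt_min hδ hε)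
    (hγε.trans (hMo.lt_changePoint hε k).le) (by linarith [hMo.changePoint_lt hε k])
    fun j => hT M hM j k
  exact ⟨j, hj.trans_le hγδ⟩

lemma eventually_exists_interval_oversegments
    (hregions : ∀ k i j, (pixelGraph n₁ n₂).Adj i j →
      (Mo.ψ k).seg.label i ≠ (Mo.ψ k).seg.label j →
      ∃ w, (Mo.ψ k).intensity i w ≠ (Mo.ψ k).intensity j w)
    (hintervals : ∀ k : Fin Mo.K, ∃ i w,
      (Mo.ψ k.succ).intensity i w ≠ (Mo.ψ k.castSucc).intensity i w)
    {δ : ℝ} (hδ : 0 < δ) :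
    ∀ᶠ T : ℕ in atTop, ∀ M : SeriesModel n₁ n₂ nw, IsMDLEstimate ε Θ T (Mo.observed x T) M →
      ∀ j : Fin (M.K + 1), ∃ k : Fin (Mo.K + 1),
        Mo.ν k.castSucc - δ < M.ν j.castSucc ∧ M.ν j.succ < Mo.ν k.succ + δ ∧
        Oversegments (M.ψ j).seg (Mo.ψ k).seg := by
  obtain ⟨γ, hγ, hγδ, hγε⟩ : ∃ γ, 0 < γ ∧ γ ≤ δ ∧ 2 * γ ≤ ε :=
    ⟨min δ (ε / 2), lt_min hδ (half_pos hε), min_le_left _ _, by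
      linarith [min_le_right δ (ε / 2)]⟩
  filter_upwards [eventually_lt_changePoint_add ha hΘ hε hMo hx hintervals hγ (by linarith),
    eventually_oversegments_of_overlapsBy ha hΘ hε hMo hx hregions hγ] with T hinside hover M hM j
  obtain ⟨k, hleft, hright, hjk⟩ := hMo.exists_interval_overlapsBy hM.1 hε hγ hγε j
    (hinside M hM j)
  exact ⟨k, by linarith, by linarith, hover M hM j k hjk⟩

end Consistency

lemma SeriesModel.ae_satisfiesLLN {Ω : Type*} [MeasurableSpace Ω] {P : Measure Ω}
    {M : SeriesModel n₁ n₂ nw} (hM : ∀ k i w, 0 ≤ (M.ψ k).intensity i w)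
    {X : Fin (M.K + 1) → ℕ → Pixel n₁ n₂ → Fin nw → Ω → ℕ}
    (hX_law : ∀ k s i w, HasLaw (X k s i w)
      (poissonMeasure ((M.ψ k).intensity i w).toNNReal) P)
    (hX_indep : iIndepFun
      (fun p : Fin (M.K + 1) × ℕ × Pixel n₁ n₂ × Fin nw => X p.1 p.2.1 p.2.2.1 p.2.2.2) P) :
    ∀ᵐ ω ∂P, M.SatisfiesLLN fun k s i w => X k s i w ω := by
  simp only [SatisfiesLLN, ae_all_iff]
  intro k i w
  have h := ae_tendsto_average_poisson (Y := fun s => X k (s + 1) i w)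
    (fun s => hX_law k (s + 1) i w) fun s t hst =>
      hX_indep.indepFun (i := (k, s + 1, i, w)) (j := (k, t + 1, i, w)) (by simpa using hst)
  rwa [Real.coe_toNNReal _ (hM k i w)] at h

theorem mainTheorem4_general {a b : ℝ} (ha : 0 < a)
    (hΘ : ∀ R, ∀ μ ∈ Θ R, ∀ h w, μ h w ∈ Set.Icc a b) (hε : 0 < ε)
    {Mo : SeriesModel n₁ n₂ nw} (hMo : Mo.Admissible ε Θ)
    (hregions : ∀ k i j, (pixelGraph n₁ n₂).Adj i j →
      (Mo.ψ k).seg.label i ≠ (Mo.ψ k).seg.label j →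
      ∃ w, (Mo.ψ k).intensity i w ≠ (Mo.ψ k).intensity j w)
    (hintervals : ∀ k : Fin Mo.K, ∃ i w,
      (Mo.ψ k.succ).intensity i w ≠ (Mo.ψ k.castSucc).intensity i w)
    {x : Fin (Mo.K + 1) → ℕ → Pixel n₁ n₂ → Fin nw → ℕ} (hx : Mo.SatisfiesLLN x)
    {M : ℕ → SeriesModel n₁ n₂ nw}
    (hM : ∀ᶠ T in atTop, IsMDLEstimate ε Θ T (Mo.observed x T) (M T)) :
    (∀ᶠ T in atTop, Mo.K ≤ (M T).K) ∧
    (∀ δ > 0, ∀ᶠ T in atTop, ∀ k : Fin Mo.K, ∃ j : Fin (M T).K,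
      |(M T).changePoint j - Mo.changePoint k| < δ) ∧
    (∀ φ : ℕ → ℕ, Tendsto φ atTop atTop → ∀ (K : ℕ) (hK : ∀ n, (M (φ n)).K = K)
      (νlim : Fin K → ℝ),
      (∀ j : Fin K, Tendsto (fun n => (M (φ n)).changePoint (Fin.cast (hK n).symm j))
        atTop (𝓝 (νlim j))) →
      Set.range Mo.changePoint ⊆ Set.range νlim) ∧
    (∀ δ > 0, ∀ᶠ T in atTop, ∀ j : Fin ((M T).K + 1), ∃ k : Fin (Mo.K + 1),
      Mo.ν k.castSucc - δ < (M T).ν j.castSucc ∧ (M T).ν j.succ < Mo.ν k.succ + δ ∧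
      Oversegments ((M T).ψ j).seg (Mo.ψ k).seg) := by
  have hnear : ∀ δ > 0, ∀ᶠ T in atTop, ∀ k : Fin Mo.K, ∃ j : Fin (M T).K,
      |(M T).changePoint j - Mo.changePoint k| < δ := fun δ hδ => by
    filter_upwards [hM,
      eventually_exists_abs_changePoint_sub_lt ha hΘ hε hMo hx hintervals hδ] with T hMT hT
    exact hT _ hMT
  refine ⟨?_, hnear, ?_, fun δ hδ => ?_⟩
  · exact (hnear (ε / 2) (half_pos hε)).mono fun T => hMo.K_le_of_abs_changePoint_sub_lt hε
  · rintro φ hφ K hK νlim hlim _ ⟨k, rfl⟩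
    refine mem_range_of_tendsto hlim fun δ hδ => (hφ.eventually (hnear δ hδ)).mono fun n hn => ?_
    obtain ⟨j, hj⟩ := hn k
    exact ⟨Fin.cast (hK n) j, hj⟩
  · filter_upwards [hM,
      eventually_exists_interval_oversegments ha hΘ hε hMo hx hregions hintervals hδ] with T hMT hT
    exact hT _ hMT

theorem mainTheorem4
    {Ω : Type*} [MeasurableSpace Ω] (P : Measure Ω) [IsProbabilityMeasure P]
    (n₁ n₂ nw : ℕ) (hnw : 0 < nw)
    -- the class of models: compact spaces of positive rates
    (Θ : (R : Segmentation n₁ n₂) → Set (Fin R.m → Fin nw → ℝ))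
    (hΘ_compact : ∀ R, IsCompact (Θ R))
    (hΘ_pos : ∀ R, ∀ μ ∈ Θ R, ∀ h w, 0 < μ h w)
    (ε : ℝ) (hε : 0 < ε)
    -- the true model
    (Mo : SeriesModel n₁ n₂ nw) (hMo : Mo.Admissible ε Θ)
    -- neighbouring true regions have different rates, in every band
    (hregions : ∀ (k : Fin (Mo.K + 1)) (i j : Pixel n₁ n₂), (pixelGraph n₁ n₂).Adj i j →
      (Mo.ψ k).seg.label i ≠ (Mo.ψ k).seg.label j →
      ∀ w : Fin nw, 0 < |(Mo.ψ k).intensity i w - (Mo.ψ k).intensity j w|)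
    -- consecutive true intervals differ, at some pixel in some band
    (hintervals : ∀ k : Fin Mo.K, ∃ (i : Pixel n₁ n₂) (w : Fin nw),
      0 < |(Mo.ψ k.succ).intensity i w - (Mo.ψ k.castSucc).intensity i w|)
    -- the photon counts
    (X : Fin (Mo.K + 1) → ℕ → Pixel n₁ n₂ → Fin nw → Ω → ℕ)
    (hX_law : ∀ k s i w, HasLaw (X k s i w)
      (poissonMeasure ((Mo.ψ k).intensity i w).toNNReal) P)
    (hX_indep : iIndepFun
      (fun p : Fin (Mo.K + 1) × ℕ × Pixel n₁ n₂ × Fin nw => X p.1 p.2.1 p.2.2.1 p.2.2.2) P)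
    -- the MDL estimator
    (est : ℕ → Ω → SeriesModel n₁ n₂ nw)
    (hest : ∀ T : ℕ, 1 ≤ T → ∀ᵐ ω ∂P,
      IsMDLEstimate ε Θ T (Mo.observed (fun k s i w => X k s i w ω) T) (est T ω)) :
    -- the number of change points is not underestimated
    (∀ᵐ ω ∂P, ∀ᶠ T : ℕ in atTop, Mo.K ≤ (est T ω).K) ∧
    -- when it is overestimated, the true change points are among the limits of the estimated ones
    (∀ᵐ ω ∂P,
      (∀ δ : ℝ, 0 < δ → ∀ᶠ T : ℕ in atTop, Mo.K < (est T ω).K →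
        ∀ k : Fin Mo.K, ∃ j : Fin (est T ω).K,
          |(est T ω).changePoint j - Mo.changePoint k| < δ) ∧
      (∀ (φ : ℕ → ℕ), StrictMono φ → ∀ (K : ℕ), Mo.K < K →
        ∀ (hK : ∀ n, (est (φ n) ω).K = K) (νlim : Fin K → ℝ),
        (∀ j : Fin K, Tendsto (fun n => (est (φ n) ω).changePoint (Fin.cast (hK n).symm j))
          atTop (𝓝 (νlim j))) →
        Set.range Mo.changePoint ⊆ Set.range νlim)) ∧
    -- every fitted interval lies, up to `δ`, in a true interval, whose segmentation is the fitted
    -- one or is oversegmented by it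
    (∀ᵐ ω ∂P, ∀ δ : ℝ, 0 < δ → ∀ᶠ T : ℕ in atTop,
      ∀ j : Fin ((est T ω).K + 1), ∃ k : Fin (Mo.K + 1),
        Mo.ν k.castSucc - δ < (est T ω).ν j.castSucc ∧
        (est T ω).ν j.succ < Mo.ν k.succ + δ ∧
        Oversegments ((est T ω).ψ j).seg (Mo.ψ k).seg) := by
  obtain ⟨a, b, ha, hΘ⟩ := exists_rates_mem_Icc hΘ_compact hΘ_pos
  have hlln := SeriesModel.ae_satisfiesLLN
    (fun k i w => (hMo.intensity_pos ha hΘ k i w).le) hX_law hX_indep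
  have hM : ∀ᵐ ω ∂P, ∀ T, 1 ≤ T →
      IsMDLEstimate ε Θ T (Mo.observed (fun k s i w => X k s i w ω) T) (est T ω) := by
    simpa only [ae_all_iff] using hest
  have hmain := (hlln.and hM).mono fun ω hω =>
    mainTheorem4_general ha hΘ hε hMo
      (fun k i j hij hl => ⟨⟨0, hnw⟩, sub_ne_zero.1 (abs_pos.1 (hregions k i j hij hl _))⟩)
      (fun k => (hintervals k).imp fun i h => h.imp fun w hw => sub_ne_zero.1 (abs_pos.1 hw))
      hω.1 (eventually_atTop.2 ⟨1, hω.2⟩)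
  refine ⟨hmain.mono fun ω h => h.1, hmain.mono fun ω h => ⟨fun δ hδ => ?_, ?_⟩,
    hmain.mono fun ω h => h.2.2.2⟩
  · exact (h.2.1 δ hδ).mono fun T hT _ => hT
  · exact fun φ hφ K _ => h.2.2.1 φ hφ.tendsto_atTop K
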